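/- Let $-\infty<a<b<\infty$. For $n\in\mathbb{N}=\{0,1,2,\dots\}$ let $D^n$ be the ordinary derivative of order $n$ on $[a,b]$ (one-sided at the end points). For $r>0$ put $J_a^r f(x)=\frac1{\Gamma(r)}\int_a^x (x-t)^{r-1}f(t)\,dt$ for $x\in[a,b]$, and let $J_a^0$ be the identity. For $\alpha>0$, $m=\lceil\alpha\rceil$ and $f\in C^{m-1}[a,b]$ let ${}^{C}\!D_a^{\alpha}f = D^m J_a^{m-\alpha}\Big(f-\sum_{k=0}^{m-1}\frac{(D^kf)(a)}{k!}(\cdot-a)^k\Big)$, and let ${}^{C}\!D_a^{0}$ be the identity. A real function $f$ on $[a,b]$ (of class $C^{\lceil\alpha\rceil-1}[a,b]$ if $\alpha>0$) is called continuously Caputo $\alpha$-differentiable, $\alpha\ge 0$, if ${}^{C}\!D_a^{\alpha}f$ exists at every point of $[a,b]$ and is continuous on $[a,b]$. Theorem 3.6. Let $\alpha>0$ and let $f\in C^{\lceil\alpha\rceil-1}[a,b]$ be continuously Caputo $\alpha$-differentiable. Then for every integer $l$ with $0\le l\le\lceil\alpha\rceil-1$: (1) $f$ is continuously Caputo $l$-differentiable,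 with ${}^{C}\!D_a^{l}f=D^lf\in C[a,b]$; (2) $D^lf$ is continuously Caputo $(\alpha-l)$-differentiable; (3) ${}^{C}\!D_a^{\alpha-l}(D^lf)={}^{C}\!D_a^{\alpha}f$ on $[a,b]$. -/

import Mathlib

open Set

noncomputable section

namespace FracCalc

/-- The Riemann-Liouville fractional integral operator of order `r ≥ 0` with base point `a`:
the identity for `r = 0`, and
`x ↦ Γ(r)⁻¹ * ∫ t in a..x, (x - t) ^ (r - 1) * f t` for `r > 0` (used for `x ≥ a`). -/
def rlIntegral (a r : ℝ) (f : ℝ → ℝ) : ℝ → ℝ := fun x =>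
  if r = 0 then f x
  else 1 / Real.Gamma r * ∫ t in a..x, (x - t) ^ (r - 1) * f t

/-- The ordinary differential operator of order `n` on `[a, b]`
(with one-sided derivatives at the end points). -/
def classicalDeriv (a b : ℝ) (n : ℕ) (f : ℝ → ℝ) : ℝ → ℝ :=
  iteratedDerivWithin n f (Icc a b)

/-- The Riemann-Liouville derivative of order `α ≥ 0` on `[a, b]`: with `m = ⌈α⌉`, the `m`-th
derivative of the fractional integral of order `m - α`. For `α = 0` this is the identity. -/
def rlDeriv (a b α : ℝ) (f : ℝ → ℝ) : ℝ → ℝ :=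
  classicalDeriv a b ⌈α⌉₊ (rlIntegral a (⌈α⌉₊ - α) f)

/-- `f` is continuous on `[a, b]` and its Riemann-Liouville derivative of order `α ≥ 0` exists at
every point of `[a, b]` and is continuous there; i.e. with `m = ⌈α⌉` the fractional integral of
order `m - α` of `f` is of class `C^m` on `[a, b]`. -/
def ContRLDifferentiable (a b α : ℝ) (f : ℝ → ℝ) : Prop :=
  ContinuousOn f (Icc a b) ∧
    ContDiffOn ℝ (⌈α⌉₊ : ℕ) (rlIntegral a (⌈α⌉₊ - α) f) (Icc a b)

/-- `f` minus its Taylor polynomial of degree `n` centred at the left end point `a`, the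
derivatives at `a` being taken within `[a, b]`. -/
def taylorRemainder (a b : ℝ) (n : ℕ) (f : ℝ → ℝ) : ℝ → ℝ := fun t =>
  f t - ∑ k ∈ Finset.range (n + 1), classicalDeriv a b k f a / (k.factorial : ℝ) * (t - a) ^ k

/-- The Caputo derivative of order `α ≥ 0` on `[a, b]`: the identity for `α = 0`; for `α > 0` and
`m = ⌈α⌉`, the Riemann-Liouville derivative of order `α` of `f` minus its Taylor polynomial of
degree `m - 1` at `a`. -/
def caputoDeriv (a b α : ℝ) (f : ℝ → ℝ) : ℝ → ℝ :=
  if α = 0 then f else rlDeriv a b α (taylorRemainder a b (⌈α⌉₊ - 1) f)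

/-- `f` is continuously Caputo `α`-differentiable on `[a, b]` (`α ≥ 0`). For `α = 0` this means
that `f` is continuous. For `α > 0` and `m = ⌈α⌉` it means that `f` is of class `C^(m-1)` on
`[a, b]` and that its Caputo derivative of order `α` exists and is continuous on `[a, b]`. -/
def ContCaputoDifferentiable (a b α : ℝ) (f : ℝ → ℝ) : Prop :=
  (α = 0 ∧ ContinuousOn f (Icc a b)) ∨
  (0 < α ∧ ContDiffOn ℝ (⌈α⌉₊ - 1 : ℕ) f (Icc a b) ∧
    ContRLDifferentiable a b α (taylorRemainder a b (⌈α⌉₊ - 1) f))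

end FracCalc

end

/-!
Write `R n f` for `f` minus its Taylor polynomial of degree `n` at `a`. If `g` is of class `C¹` and
`g a = 0`, then `J^r g` is differentiable with derivative `J^r g'`: after extending `g` by zero to
the left of `a`, `J^r g` is a convolution of the integrable kernel `s ^ (r - 1)` with a Lipschitz
function, which may be differentiated under the integral sign. All derivatives of order `< l` of
`R (n + l) f` vanish at `a`, so `D^l J^r R (n + l) f = J^r D^l R (n + l) f = J^r R n (D^l f)`.
Taking `⌈α⌉ = n + l + 1` and `r = ⌈α⌉ - α = ⌈α - l⌉ - (α - l)`, a further `n + 1` derivatives give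
the equality of the Caputo derivatives.
-/

open MeasureTheory
open scoped NNReal

section IteratedDerivWithin

variable {𝕜 E : Type*} [NontriviallyNormedField 𝕜] [NormedAddCommGroup E] [NormedSpace 𝕜 E]
  {f : 𝕜 → E} {s : Set 𝕜}

theorem iteratedDerivWithin_iteratedDerivWithin (m n : ℕ) (f : 𝕜 → E) (s : Set 𝕜) :
    iteratedDerivWithin m (iteratedDerivWithin n f s) s = iteratedDerivWithin (m + n) f s := by
  induction n generalizing f with
  | zero => simp
  | succ n ih => rw [iteratedDerivWithin_succ', ih, ← add_assoc, iteratedDerivWithin_succ']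

theorem contDiffOn_iteratedDerivWithin {m n : ℕ} (hs : UniqueDiffOn 𝕜 s)
    (hf : ContDiffOn 𝕜 (m + n : ℕ) f s) : ContDiffOn 𝕜 m (iteratedDerivWithin n f s) s := by
  induction n generalizing f with
  | zero => simpa using hf
  | succ n ih =>
    rw [iteratedDerivWithin_succ']
    exact ih (hf.derivWithin hs (by norm_cast))

end IteratedDerivWithin

section Taylor

variable {E : Type*} [NormedAddCommGroup E] [NormedSpace ℝ E] {f : ℝ → E} {s : Set ℝ}

theorem contDiff_taylorWithinEval (f : ℝ → E) (n : ℕ) (s : Set ℝ) (x₀ : ℝ) {m : WithTop ℕ∞} :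
    ContDiff ℝ m (taylorWithinEval f n s x₀) := by
  rw [funext (taylor_within_apply f n s x₀)]
  fun_prop

theorem iteratedDerivWithin_taylorWithinEval (hs : UniqueDiffOn ℝ s) (f : ℝ → E) (k n : ℕ)
    (x₀ : ℝ) :
    EqOn (iteratedDerivWithin k (taylorWithinEval f (n + k) s x₀) s)
      (taylorWithinEval (iteratedDerivWithin k f s) n s x₀) s := by
  induction k generalizing f with
  | zero => simpa using eqOn_refl _ _
  | succ k ih =>
    have hderiv : EqOn (derivWithin (taylorWithinEval f (n + k + 1) s x₀) s)
        (taylorWithinEval (derivWithin f s) (n + k) s x₀) s := fun x hx =>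
      (hasDerivAt_taylorWithinEval_succ f (n + k)).hasDerivWithinAt.derivWithin (hs x hx)
    rw [← add_assoc, iteratedDerivWithin_succ', iteratedDerivWithin_succ']
    exact (iteratedDerivWithin_congr hderiv).trans (ih _)

theorem iteratedDerivWithin_succ_taylorWithinEval (hs : UniqueDiffOn ℝ s) (f : ℝ → E) (n : ℕ)
    (x₀ : ℝ) : EqOn (iteratedDerivWithin (n + 1) (taylorWithinEval f n s x₀) s) 0 s := by
  have hconst := iteratedDerivWithin_taylorWithinEval hs f n 0 x₀
  simp only [zero_add] at hconst
  intro x hx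
  rw [iteratedDerivWithin_succ, derivWithin_congr hconst (hconst hx),
    funext (taylor_within_zero_eval _ s x₀), derivWithin_fun_const]

end Taylor

section Convolution

variable {E : Type*} [NormedAddCommGroup E] [NormedSpace ℝ E] [FiniteDimensional ℝ E]

/-- By Rademacher's theorem `H` is differentiable almost everywhere, and its Lipschitz constant
dominates the difference quotients. -/
theorem hasDerivAt_integral_smul_comp_sub_of_lipschitzWith {k : ℝ → ℝ} {H : ℝ → E} {K : ℝ≥0}
    {c d : ℝ} (hk : IntervalIntegrable k volume c d) (hH : LipschitzWith K H) (x : ℝ) :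
    HasDerivAt (fun y => ∫ s in c..d, k s • H (y - s)) (∫ s in c..d, k s • deriv H (x - s)) x := by
  have hk_meas : AEStronglyMeasurable k (volume.restrict (uIoc c d)) :=
    hk.def'.aestronglyMeasurable
  have hH_cont (y : ℝ) : Continuous fun s => H (y - s) :=
    hH.continuous.comp (continuous_const.sub continuous_id)
  have hH_deriv : ∀ᵐ s, DifferentiableAt ℝ H (x - s) :=
    (quasiMeasurePreserving_sub_left volume x).ae hH.ae_differentiableAt
  refine (intervalIntegral.hasDerivAt_integral_of_dominated_loc_of_lip
    (bound := fun s => ‖k s‖ * K) Filter.univ_mem ?_ ?_ ?_ ?_ (hk.norm.mul_const _) ?_).2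
  · exact .of_forall fun y => hk_meas.smul (hH_cont y).aestronglyMeasurable
  · exact hk.smul_continuousOn (hH_cont x).continuousOn
  · exact hk_meas.smul ((stronglyMeasurable_deriv H).comp_measurable
      (measurable_const.sub measurable_id)).aestronglyMeasurable
  · refine .of_forall fun s _ => (LipschitzWith.of_dist_le_mul fun y z => ?_).lipschitzOnWith
    calc dist (k s • H (y - s)) (k s • H (z - s))
        = ‖k s‖ * dist (H (y - s)) (H (z - s)) := dist_smul₀ _ _ _
      _ ≤ ‖k s‖ * (K * dist y z) := by
          gcongr
          simpa using hH.dist_le_mul (y - s) (z - s)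
      _ = Real.nnabs (‖k s‖ * K) * dist y z := by simp [mul_assoc]
  · filter_upwards [hH_deriv] with s hs _
    exact (hs.hasDerivAt.comp_sub_const x s).const_smul (k s)

end Convolution

theorem lipschitzWith_IccExtend {F : Type*} [PseudoEMetricSpace F] {a b : ℝ} (hab : a ≤ b)
    {g : ℝ → F} {K : ℝ≥0} (hg : LipschitzOnWith K g (Icc a b)) :
    LipschitzWith K (IccExtend hab (domRestrict (Icc a b) g)) := by
  have hcomp := hg.to_restrict.comp (LipschitzWith.projIcc hab)
  rwa [mul_one] at hcomp

namespace FracCalc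

variable {a b r x α : ℝ} {f g : ℝ → ℝ} {k l n p : ℕ}

@[simp]
theorem rlIntegral_zero (a : ℝ) (f : ℝ → ℝ) : rlIntegral a 0 f = f := by
  ext
  simp [rlIntegral]

theorem rlIntegral_of_ne_zero (hr : r ≠ 0) (a : ℝ) (f : ℝ → ℝ) (x : ℝ) :
    rlIntegral a r f x = 1 / Real.Gamma r * ∫ t in a..x, (x - t) ^ (r - 1) * f t :=
  if_neg hr

theorem rlIntegral_congr_Ioo (hr : r ≠ 0) (h : EqOn f g (Ioo a b)) :
    EqOn (rlIntegral a r f) (rlIntegral a r g) (Icc a b) := by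
  intro x hx
  rw [rlIntegral_of_ne_zero hr, rlIntegral_of_ne_zero hr,
    intervalIntegral.integral_congr_Ioo_of_le hx.1]
  intro t ht
  simp only [h ⟨ht.1, ht.2.trans_le hx.2⟩]

theorem rlIntegral_congr (h : EqOn f g (Icc a b)) :
    EqOn (rlIntegral a r f) (rlIntegral a r g) (Icc a b) := by
  rcases eq_or_ne r 0 with rfl | hr
  · simpa using h
  · exact rlIntegral_congr_Ioo hr (h.mono Ioo_subset_Icc_self)

theorem rlIntegral_eq_integral_comp_sub {c : ℝ} (hr : r ≠ 0) (hg : EqOn g 0 (Iio a))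
    (hax : a ≤ x) (hxc : x - a ≤ c) :
    rlIntegral a r g x = 1 / Real.Gamma r * ∫ s in 0..c, s ^ (r - 1) • g (x - s) := by
  have hsub : ∫ t in a..x, (x - t) ^ (r - 1) * g t
      = ∫ s in 0..(x - a), s ^ (r - 1) • g (x - s) := by
    simpa using intervalIntegral.integral_comp_sub_left (a := a) (b := x)
      (fun s => s ^ (r - 1) • g (x - s)) x
  have hxa : 0 ≤ x - a := sub_nonneg.2 hax
  rw [rlIntegral_of_ne_zero hr, hsub, intervalIntegral.integral_of_le hxa,
    intervalIntegral.integral_of_le (hxa.trans hxc)]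
  congr 1
  refine (setIntegral_eq_of_subset_of_forall_sdiff_eq_zero measurableSet_Ioc
    (Ioc_subset_Ioc_right hxc) fun s hs => ?_).symm
  have hs' : x - a < s := not_le.1 fun h => hs.2 ⟨hs.1.1, h⟩
  rw [hg (show x - s < a by linarith), Pi.zero_apply, smul_zero]

/-- Extending `g` by the constants `g a = 0` and `g b` keeps it Lipschitz and turns its fractional
integral into a convolution over a fixed interval. -/
theorem hasDerivWithinAt_rlIntegral_of_lipschitzOnWith {K : ℝ≥0} (hr : 0 < r)
    (hg : LipschitzOnWith K g (Icc a b)) (hga : g a = 0) (hx : x ∈ Icc a b) :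
    HasDerivWithinAt (rlIntegral a r g) (rlIntegral a r (deriv g) x) (Icc a b) x := by
  have hab : a ≤ b := hx.1.trans hx.2
  set H : ℝ → ℝ := IccExtend hab (domRestrict (Icc a b) g)
  have hgH : EqOn g H (Icc a b) := fun y hy => (IccExtend_of_mem hab (domRestrict _ g) hy).symm
  have hH_zero : EqOn H 0 (Iio a) := fun y hy =>
    (IccExtend_of_le_left hab (domRestrict _ g) (le_of_lt hy)).trans hga
  have hH_deriv_zero : EqOn (deriv H) 0 (Iio a) := by
    simpa using hH_zero.deriv isOpen_Iio
  have hgH_deriv : EqOn (deriv g) (deriv H) (Ioo a b) :=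
    (hgH.mono Ioo_subset_Icc_self).deriv isOpen_Ioo
  have hconv (u : ℝ → ℝ) (hu : EqOn u 0 (Iio a)) {y : ℝ} (hy : y ∈ Icc a b) :
      rlIntegral a r u y = 1 / Real.Gamma r * ∫ s in 0..(b - a), s ^ (r - 1) • u (y - s) :=
    rlIntegral_eq_integral_comp_sub hr.ne' hu hy.1 (by linarith [hy.2])
  have hkernel : IntervalIntegrable (fun s : ℝ => s ^ (r - 1)) volume 0 (b - a) :=
    intervalIntegral.intervalIntegrable_rpow' (by linarith)
  rw [rlIntegral_congr_Ioo hr.ne' hgH_deriv hx, hconv _ hH_deriv_zero hx]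
  refine ((hasDerivAt_integral_smul_comp_sub_of_lipschitzWith hkernel
    (lipschitzWith_IccExtend hab hg) x).const_mul _).hasDerivWithinAt.congr_of_mem
      (fun y hy => ?_) hx
  rw [rlIntegral_congr hgH hy, hconv _ hH_zero hy]

theorem hasDerivWithinAt_rlIntegral (hr : 0 ≤ r) (hg : ContDiffOn ℝ 1 g (Icc a b))
    (hga : g a = 0) (hx : x ∈ Icc a b) :
    HasDerivWithinAt (rlIntegral a r g) (rlIntegral a r (derivWithin g (Icc a b)) x)
      (Icc a b) x := by
  rcases hr.eq_or_lt with rfl | hr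
  · simpa using (hg.differentiableOn one_ne_zero x hx).hasDerivWithinAt
  · obtain ⟨K, hK⟩ := hg.exists_lipschitzOnWith one_ne_zero (convex_Icc a b) isCompact_Icc
    have hderiv : EqOn (derivWithin g (Icc a b)) (deriv g) (Ioo a b) := fun y hy =>
      derivWithin_of_mem_nhds (Icc_mem_nhds hy.1 hy.2)
    rw [rlIntegral_congr_Ioo hr.ne' hderiv hx]
    exact hasDerivWithinAt_rlIntegral_of_lipschitzOnWith hr hK hga hx

theorem classicalDeriv_rlIntegral (hab : a < b) (hr : 0 ≤ r) (hg : ContDiffOn ℝ n g (Icc a b))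
    (hga : ∀ k < n, classicalDeriv a b k g a = 0) :
    EqOn (classicalDeriv a b n (rlIntegral a r g)) (rlIntegral a r (classicalDeriv a b n g))
      (Icc a b) := by
  unfold classicalDeriv at *
  have hs : UniqueDiffOn ℝ (Icc a b) := uniqueDiffOn_Icc hab
  induction n generalizing g with
  | zero => simpa using eqOn_refl _ _
  | succ n ih =>
    have hg_deriv : ContDiffOn ℝ n (derivWithin g (Icc a b)) (Icc a b) :=
      hg.derivWithin hs (by norm_cast)
    have hcomm : EqOn (derivWithin (rlIntegral a r g) (Icc a b))
        (rlIntegral a r (derivWithin g (Icc a b))) (Icc a b) := fun x hx =>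
      (hasDerivWithinAt_rlIntegral hr (hg.of_le (by norm_cast; omega))
        (by simpa using hga 0 n.succ_pos) hx).derivWithin (hs x hx)
    rw [iteratedDerivWithin_succ', iteratedDerivWithin_succ']
    refine (iteratedDerivWithin_congr hcomm).trans (ih hg_deriv fun k hk => ?_)
    rw [← iteratedDerivWithin_succ']
    exact hga (k + 1) (by omega)

theorem taylorRemainder_eq_sub_taylorWithinEval (a b : ℝ) (n : ℕ) (f : ℝ → ℝ) :
    taylorRemainder a b n f = f - taylorWithinEval f n (Icc a b) a := by
  ext x
  simp only [taylorRemainder, classicalDeriv, Pi.sub_apply, taylor_within_apply, smul_eq_mul]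
  congr 1
  exact Finset.sum_congr rfl fun k _ => by ring

theorem taylorRemainder_left : taylorRemainder a b n f a = 0 := by
  simp [taylorRemainder_eq_sub_taylorWithinEval]

theorem contDiffOn_taylorRemainder {m : WithTop ℕ∞} (hf : ContDiffOn ℝ m f (Icc a b)) :
    ContDiffOn ℝ m (taylorRemainder a b n f) (Icc a b) := by
  rw [taylorRemainder_eq_sub_taylorWithinEval]
  exact hf.sub (contDiff_taylorWithinEval f n _ a).contDiffOn

theorem classicalDeriv_taylorRemainder_eq_sub (hab : a < b) (hf : ContDiffOn ℝ k f (Icc a b)) :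
    EqOn (classicalDeriv a b k (taylorRemainder a b n f))
      (classicalDeriv a b k f - classicalDeriv a b k (taylorWithinEval f n (Icc a b) a))
      (Icc a b) := by
  rw [taylorRemainder_eq_sub_taylorWithinEval]
  exact fun x hx => iteratedDerivWithin_sub hx (uniqueDiffOn_Icc hab) (hf x hx)
    (contDiff_taylorWithinEval f n _ a).contDiffWithinAt

theorem classicalDeriv_taylorRemainder (hab : a < b) (hf : ContDiffOn ℝ k f (Icc a b)) :
    EqOn (classicalDeriv a b k (taylorRemainder a b (n + k) f))
      (taylorRemainder a b n (classicalDeriv a b k f)) (Icc a b) := by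
  intro x hx
  rw [classicalDeriv_taylorRemainder_eq_sub hab hf hx, taylorRemainder_eq_sub_taylorWithinEval,
    Pi.sub_apply, Pi.sub_apply]
  exact congrArg _ (iteratedDerivWithin_taylorWithinEval (uniqueDiffOn_Icc hab) f k n a hx)

theorem classicalDeriv_taylorRemainder_left (hab : a < b) (hf : ContDiffOn ℝ k f (Icc a b))
    (hk : k ≤ n) : classicalDeriv a b k (taylorRemainder a b n f) a = 0 := by
  obtain ⟨j, rfl⟩ := Nat.exists_eq_add_of_le' hk
  rw [classicalDeriv_taylorRemainder hab hf (left_mem_Icc.2 hab.le), taylorRemainder_left]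

theorem classicalDeriv_succ_taylorRemainder (hab : a < b)
    (hf : ContDiffOn ℝ (n + 1 : ℕ) f (Icc a b)) :
    EqOn (classicalDeriv a b (n + 1) (taylorRemainder a b n f)) (classicalDeriv a b (n + 1) f)
      (Icc a b) := by
  intro x hx
  have hpoly : classicalDeriv a b (n + 1) (taylorWithinEval f n (Icc a b) a) x = 0 :=
    iteratedDerivWithin_succ_taylorWithinEval (uniqueDiffOn_Icc hab) f n a hx
  rw [classicalDeriv_taylorRemainder_eq_sub hab hf hx, Pi.sub_apply, hpoly, sub_zero]

theorem classicalDeriv_rlIntegral_taylorRemainder (hab : a < b) (hr : 0 ≤ r)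
    (hf : ContDiffOn ℝ l f (Icc a b)) :
    EqOn (classicalDeriv a b l (rlIntegral a r (taylorRemainder a b (n + l) f)))
      (rlIntegral a r (taylorRemainder a b n (classicalDeriv a b l f))) (Icc a b) :=
  (classicalDeriv_rlIntegral hab hr (contDiffOn_taylorRemainder hf) fun _ hk =>
    classicalDeriv_taylorRemainder_left hab (hf.of_le (by exact_mod_cast hk.le))
      (by omega)).trans
    (rlIntegral_congr (classicalDeriv_taylorRemainder hab hf))

theorem contCaputoDifferentiable_iff_of_ceil_eq (hα : ⌈α⌉₊ = n + 1) :
    ContCaputoDifferentiable a b α f ↔ ContDiffOn ℝ n f (Icc a b) ∧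
      ContDiffOn ℝ (n + 1 : ℕ) (rlIntegral a ((n + 1 : ℕ) - α) (taylorRemainder a b n f))
        (Icc a b) := by
  have hα_pos : 0 < α := Nat.ceil_pos.1 (hα ▸ n.succ_pos)
  simp only [ContCaputoDifferentiable, ContRLDifferentiable, hα_pos, hα_pos.ne', hα,
    Nat.add_sub_cancel, false_and, false_or, true_and]
  exact and_congr_right fun hf => and_iff_right (contDiffOn_taylorRemainder hf).continuousOn

theorem caputoDeriv_of_ceil_eq (hα : ⌈α⌉₊ = n + 1) :
    caputoDeriv a b α f =
      classicalDeriv a b (n + 1) (rlIntegral a ((n + 1 : ℕ) - α) (taylorRemainder a b n f)) := by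
  have hα_pos : 0 < α := Nat.ceil_pos.1 (hα ▸ n.succ_pos)
  rw [caputoDeriv, if_neg hα_pos.ne', rlDeriv, hα, Nat.add_sub_cancel]

theorem contCaputoDifferentiable_natCast (hf : ContDiffOn ℝ n f (Icc a b)) :
    ContCaputoDifferentiable a b n f := by
  cases n with
  | zero => exact Or.inl ⟨Nat.cast_zero, hf.continuousOn⟩
  | succ n =>
    rw [contCaputoDifferentiable_iff_of_ceil_eq (Nat.ceil_natCast _), sub_self, rlIntegral_zero]
    exact ⟨hf.of_le (by norm_cast; omega), contDiffOn_taylorRemainder hf⟩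

theorem caputoDeriv_natCast (hab : a < b) (hf : ContDiffOn ℝ n f (Icc a b)) :
    EqOn (caputoDeriv a b n f) (classicalDeriv a b n f) (Icc a b) := by
  cases n with
  | zero => simpa [caputoDeriv, classicalDeriv] using eqOn_refl _ _
  | succ n =>
    rw [caputoDeriv_of_ceil_eq (Nat.ceil_natCast _), sub_self, rlIntegral_zero]
    exact classicalDeriv_succ_taylorRemainder hab hf

theorem exists_ceil_sub_natCast_eq_succ (hl : (l : ℝ) < α) :
    ∃ n, ⌈α - l⌉₊ = n + 1 ∧ ⌈α⌉₊ = n + l + 1 := by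
  have hl' : l < ⌈α⌉₊ := Nat.lt_ceil.2 hl
  refine ⟨⌈α⌉₊ - l - 1, ?_, by omega⟩
  rw [Nat.ceil_sub_natCast]
  omega

/-- The fractional integral has the same order `⌈α⌉ - α` for the exponents `α` and `α - l`. -/
theorem rlIntegral_taylorRemainder_classicalDeriv (hab : a < b) (hα : ⌈α⌉₊ = n + l + 1)
    (hf : ContDiffOn ℝ l f (Icc a b)) :
    EqOn
      (rlIntegral a ((n + 1 : ℕ) - (α - l)) (taylorRemainder a b n (classicalDeriv a b l f)))
      (classicalDeriv a b l
        (rlIntegral a ((n + l + 1 : ℕ) - α) (taylorRemainder a b (n + l) f))) (Icc a b) := by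
  have hr : ((n + 1 : ℕ) : ℝ) - (α - l) = (n + l + 1 : ℕ) - α := by push_cast; ring
  have hr_nonneg : 0 ≤ ((n + l + 1 : ℕ) : ℝ) - α := by
    rw [← hα]
    exact sub_nonneg.2 (Nat.le_ceil α)
  rw [hr]
  exact (classicalDeriv_rlIntegral_taylorRemainder hab hr_nonneg hf).symm

theorem contCaputoDifferentiable_classicalDeriv (hab : a < b)
    (hf : ContCaputoDifferentiable a b α f) (hl : (l : ℝ) < α) :
    ContCaputoDifferentiable a b (α - l) (classicalDeriv a b l f) := by
  obtain ⟨n, hαl, hα⟩ := exists_ceil_sub_natCast_eq_succ hl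
  obtain ⟨hf, hJ⟩ := (contCaputoDifferentiable_iff_of_ceil_eq hα).1 hf
  rw [add_right_comm] at hJ
  refine (contCaputoDifferentiable_iff_of_ceil_eq hαl).2
    ⟨contDiffOn_iteratedDerivWithin (uniqueDiffOn_Icc hab) hf, ?_⟩
  refine (contDiffOn_iteratedDerivWithin (uniqueDiffOn_Icc hab) hJ).congr ?_
  rw [add_right_comm]
  exact rlIntegral_taylorRemainder_classicalDeriv hab hα (hf.of_le (by norm_cast; omega))

theorem caputoDeriv_classicalDeriv (hab : a < b) (hf : ContDiffOn ℝ l f (Icc a b))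
    (hl : (l : ℝ) < α) :
    EqOn (caputoDeriv a b (α - l) (classicalDeriv a b l f)) (caputoDeriv a b α f) (Icc a b) := by
  obtain ⟨n, hαl, hα⟩ := exists_ceil_sub_natCast_eq_succ hl
  rw [caputoDeriv_of_ceil_eq hαl, caputoDeriv_of_ceil_eq hα]
  refine (iteratedDerivWithin_congr
    (rlIntegral_taylorRemainder_classicalDeriv hab hα hf)).trans fun x _ => ?_
  unfold classicalDeriv
  rw [iteratedDerivWithin_iteratedDerivWithin, add_right_comm]

end FracCalc

theorem theorem3p6 (a b : ℝ) (hab : a < b) (α : ℝ) (hα : 0 < α) (f : ℝ → ℝ)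
    (hf : ContDiffOn ℝ (⌈α⌉₊ - 1 : ℕ) f (Set.Icc a b))
    (hfα : FracCalc.ContCaputoDifferentiable a b α f)
    (l : ℕ) (hl : l ≤ ⌈α⌉₊ - 1) :
    FracCalc.ContCaputoDifferentiable a b (l : ℝ) f ∧
    Set.EqOn (FracCalc.caputoDeriv a b (l : ℝ) f) (FracCalc.classicalDeriv a b l f)
      (Set.Icc a b) ∧
    ContinuousOn (FracCalc.classicalDeriv a b l f) (Set.Icc a b) ∧
    FracCalc.ContCaputoDifferentiable a b (α - l) (FracCalc.classicalDeriv a b l f) ∧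
    Set.EqOn (FracCalc.caputoDeriv a b (α - l) (FracCalc.classicalDeriv a b l f))
      (FracCalc.caputoDeriv a b α f) (Set.Icc a b) := by
  have hlα : (l : ℝ) < α := Nat.lt_ceil.1 (by have := Nat.ceil_pos.2 hα; omega)
  have hfl : ContDiffOn ℝ l f (Icc a b) := hf.of_le (by exact_mod_cast hl)
  have hDf : ContinuousOn (FracCalc.classicalDeriv a b l f) (Icc a b) :=
    hfl.continuousOn_iteratedDerivWithin le_rfl (uniqueDiffOn_Icc hab)
  exact ⟨FracCalc.contCaputoDifferentiable_natCast hfl, FracCalc.caputoDeriv_natCast hab hfl, hDf,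
    FracCalc.contCaputoDifferentiable_classicalDeriv hab hfα hlα,
    FracCalc.caputoDeriv_classicalDeriv hab hfl hlα⟩
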